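/- Let $X=\mathbb{R}/\mathbb{Z}$ with its quotient metric, let $T(x)=2x$ be the doubling map on $X$, let $\ell$ be the Lebesgue measure on $X$ with $\ell(X)=1$, and let $0<\lambda<1$. Let $m\ge 1$ be an integer, $\mathcal{C}=\{0,\dots,m-1\}$, $\mathcal{I}=\{0,1\}$, and let $A_c:X\to\mathbb{R}$, $c\in\mathcal{C}$, be Lipschitz functions. For $i\in\mathcal{I}$ let $\tau_i:X\to X$ be the inverse branch of $T$ given by $\tau_i(x)=\frac{x}{2}+\frac{i}{2}$, where $x$ is represented in $[0,1)$. For $x\in X$, $\bar c=(c_0,c_1,\dots)\in\mathcal{C}^{\mathbb{N}}$ and $\bar a=(a_0,a_1,\dots)\in\mathcal{I}^{\mathbb{N}}$ put $$S_x(\bar c,\bar a)=\sum_{i=0}^{\infty}\lambda^{i}A_{c_i}\big(\tau_{a_i}\circ\tau_{a_{i-1}}\circ\cdots\circ\tau_{a_0}(x)\big).$$ Write the elements of a further copy of $\mathcal{C}^{\mathbb{N}}$ as $\bar b=(b_{-1},b_{-2},\dots)$, let $\sigma\bar b=(b_{-2},b_{-3},\dots)$ be the shift, and define the maps $$G_c(x,y)=(T(x),A_c(x)+\lambda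 y)\ \text{ on } X\times\mathbb{R},\qquad G(x,y,\bar b)=(G_{b_{-1}}(x,y),\sigma\bar b)\ \text{ on } X\times\mathbb{R}\times\mathcal{C}^{\mathbb{N}},$$ $$\Psi:X\times\mathcal{I}^{\mathbb{N}}\times\mathcal{C}^{\mathbb{N}}\times\mathcal{C}^{\mathbb{N}}\to X\times\mathbb{R}\times\mathcal{C}^{\mathbb{N}},\qquad \Psi(x,\bar a,\bar c,\bar b)=(x,S_x(\bar c,\bar a),\bar b).$$ Let $\eta$ and $\nu$ be the uniform Bernoulli (product) measures on $\mathcal{I}^{\mathbb{N}}$ and $\mathcal{C}^{\mathbb{N}}$, that is, each symbol has probability $\frac12$, respectively $\frac1m$. Let $\mu=\Psi_*(\ell\times\eta\times\nu\times\nu)$; this measure is called the random SRB measure of the IFS $(X\times\mathbb{R},G_c)_{c\in\mathcal{C}}$. **Theorem.** The measure $\mu$ is a probability measure on $X\times\mathbb{R}\times\mathcal{C}^{\mathbb{N}}$ which is invariant and ergodic with respect to $G$. In particular, for every $g\in L^1(\mu)$ and for $\mu$-almost every $(x,y,\bar b)$, $$\lim_{N\to\infty}\frac1N\sum_{j=0}^{N-1}g\big(G^{j}(x,y,\bar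 b)\big)=\int_{X\times\mathbb{R}\times\mathcal{C}^{\mathbb{N}}}g\,d\mu .$$ -/

import Mathlib

open MeasureTheory Filter Topology

noncomputable section

namespace SkewIFS

/-- The circle `ℝ / ℤ`. -/
abbrev Circle1 : Type := UnitAddCircle

/-- The doubling map `T x = 2 x` on the circle. -/
def doubling (x : Circle1) : Circle1 := (2 : ℕ) • x

/-- The representative in `[0, 1)` of a point of the circle. -/
def rep (x : Circle1) : ℝ := (AddCircle.equivIco (1 : ℝ) 0 x : ℝ)

/-- The inverse branches `τ i x = x / 2 + i / 2` of the doubling map, where `x ∈ [0, 1)`. -/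
def tau (i : Fin 2) (x : Circle1) : Circle1 := ((rep x / 2 + (i : ℝ) / 2 : ℝ) : Circle1)

/-- The composition `τ_{a (n-1)} ∘ ⋯ ∘ τ_{a 0}` of `n` inverse branches (the identity if `n = 0`). -/
def tauIter (a : ℕ → Fin 2) : ℕ → Circle1 → Circle1
  | 0, x => x
  | n + 1, x => tau (a n) (tauIter a n x)

/-- The discounted sum `S_x(c, a) = ∑ i, lam ^ i * A_{c i} (τ_{a i} ∘ ⋯ ∘ τ_{a 0} (x))`. -/
def discSum {m : ℕ} (lam : ℝ) (A : Fin m → Circle1 → ℝ) (x : Circle1)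
    (c : ℕ → Fin m) (a : ℕ → Fin 2) : ℝ :=
  ∑' i : ℕ, lam ^ i * A (c i) (tauIter a (i + 1) x)

/-- The Baker-like map `G_c (x, y) = (T x, A_c x + lam * y)` on the cylinder. -/
def baker {m : ℕ} (lam : ℝ) (A : Fin m → Circle1 → ℝ) (c : Fin m) (p : Circle1 × ℝ) :
    Circle1 × ℝ :=
  (doubling p.1, A c p.1 + lam * p.2)

/-- The left shift on sequences. -/
def shift {α : Type*} (b : ℕ → α) : ℕ → α := fun n => b (n + 1)

/-- The skew map `G (x, y, b) = (G_{b 0} (x, y), σ b)`; the first entry of the sequence `b`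
(with index `-1` in the usual notation) is `b 0`. -/
def skew {m : ℕ} (lam : ℝ) (A : Fin m → Circle1 → ℝ) (p : Circle1 × ℝ × (ℕ → Fin m)) :
    Circle1 × ℝ × (ℕ → Fin m) :=
  ((baker lam A (p.2.2 0) (p.1, p.2.1)).1, (baker lam A (p.2.2 0) (p.1, p.2.1)).2, shift p.2.2)

/-- The coding map `Ψ (x, a, c, b) = (x, S_x(c, a), b)`. -/
def coding {m : ℕ} (lam : ℝ) (A : Fin m → Circle1 → ℝ)
    (q : Circle1 × (ℕ → Fin 2) × (ℕ → Fin m) × (ℕ → Fin m)) : Circle1 × ℝ × (ℕ → Fin m) :=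
  (q.1, discSum lam A q.1 q.2.2.1 q.2.1, q.2.2.2)

/-- The uniform Bernoulli measure on sequences of `k` symbols. -/
def bernoulliMeasure (k : ℕ) [NeZero k] : Measure (ℕ → Fin k) :=
  Measure.infinitePi fun _ : ℕ => (PMF.uniformOfFintype (Fin k)).toMeasure

/-- The random SRB measure: the image under `Ψ` of `ℓ × η × ν × ν`, where `ℓ` is Lebesgue measure
on the circle (of total mass one) and `η`, `ν` are the uniform Bernoulli measures. -/
def randomSRB {m : ℕ} [NeZero m] (lam : ℝ) (A : Fin m → Circle1 → ℝ) :
    Measure (Circle1 × ℝ × (ℕ → Fin m)) :=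
  Measure.map (coding lam A)
    ((volume : Measure Circle1).prod
      ((bernoulliMeasure 2).prod ((bernoulliMeasure m).prod (bernoulliMeasure m))))

end SkewIFS

end

/-!
The skew map is the base map `(x, b) ↦ (2 x, σ b)` with a real fibre variable `y` that is contracted
by the factor `lam` at each step.

*Invariance.* Recording the binary digit that the doubling map forgets, and the symbol that the shift
forgets, turns the base map into an invertible map `codedSkew` of the coding space, which preserves
the product measure because the digit of `x` is independent of `2 x` (`volume_digit_inter`). The
functional equation `S_{2x}(b₀ c, a₀ a) = A_{b₀}(x) + lam * S_x(c, a)`, where `a₀` is the digit of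
`x`, says that the coding map carries `codedSkew` to the skew map (`coding_codedSkew`).

*Ergodicity.* The base map is an endomorphism of the compact group `ℝ/ℤ × (ℤ/m)^ℕ`, the product
measure is its Haar measure, and the points eventually mapped to `0` are dense, so it is ergodic
(`ergodic_baseHom`). Two points of the same fibre have asymptotic orbits, so a continuous compactly
supported `φ` that approximates the indicator of an invariant set `E` gives approximations
`φ (G^n (x, 0, b))` of that indicator that depend on the base point only. Thus `E` is, up to a null
set, the preimage of an invariant set of the base (`Ergodic.of_asymptotic_section`).

*Time averages.* The last claim is Birkhoff's theorem (`ErgodicThm.tendsto_birkhoffSum`). If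
`∫ f < 0`, the invariant set on which the Birkhoff sums of `f` are unbounded above is null: otherwise
it has full measure and the maximal ergodic theorem gives `0 ≤ ∫ f`. Applying this to
`f - ∫ f - ε`, and likewise with `-f` in place of `f`, yields the limit.
-/

/-! ### The pointwise ergodic theorem -/

namespace ErgodicThm

variable {α : Type*}

/-- The maximal function `max_{0 ≤ n ≤ N} S_n f`, where `S_n f = ∑_{j < n} f ∘ T^j`, in the recursive
form that exhibits its behaviour under `T`. -/
def maxBirkhoff (T : α → α) (f : α → ℝ) : ℕ → α → ℝ
  | 0, _ => 0
  | N + 1, x => max 0 (f x + maxBirkhoff T f N (T x))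

variable {T : α → α} {f : α → ℝ}

lemma maxBirkhoff_nonneg (N : ℕ) (x : α) : 0 ≤ maxBirkhoff T f N x := by
  cases N with
  | zero => exact le_rfl
  | succ N => exact le_max_left _ _

lemma maxBirkhoff_le_succ (N : ℕ) (x : α) :
    maxBirkhoff T f N x ≤ maxBirkhoff T f (N + 1) x := by
  induction N generalizing x with
  | zero => exact maxBirkhoff_nonneg _ _
  | succ N ih => exact max_le_max le_rfl (add_le_add le_rfl (ih (T x)))

lemma maxBirkhoff_mono (x : α) : Monotone fun N => maxBirkhoff T f N x :=
  monotone_nat_of_le_succ fun N => maxBirkhoff_le_succ N x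

lemma birkhoffSum_le_maxBirkhoff (N : ℕ) (x : α) :
    birkhoffSum T f N x ≤ maxBirkhoff T f N x := by
  induction N generalizing x with
  | zero => simp [maxBirkhoff]
  | succ N ih =>
    rw [birkhoffSum_succ']
    exact (add_le_add le_rfl (ih (T x))).trans (le_max_right _ _)

/-- The pointwise inequality behind the maximal ergodic theorem: where the maximum is positive, it
is attained at a time `n ≥ 1`, so one step of the orbit can be split off. -/
lemma maxBirkhoff_sub_le_indicator (N : ℕ) (x : α) :
    maxBirkhoff T f N x - maxBirkhoff T f N (T x) ≤
      {x | 0 < maxBirkhoff T f N x}.indicator f x := by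
  have h0 := maxBirkhoff_nonneg (T := T) (f := f) N (T x)
  by_cases hx : 0 < maxBirkhoff T f N x
  · rw [Set.indicator_of_mem (by exact hx)]
    cases N with
    | zero => simp [maxBirkhoff] at hx
    | succ N =>
      have h1 := maxBirkhoff_le_succ (T := T) (f := f) N (T x)
      have h2 : maxBirkhoff T f (N + 1) x = f x + maxBirkhoff T f N (T x) := by
        rw [maxBirkhoff] at hx ⊢
        exact max_eq_right (by by_contra h; rw [max_eq_left (not_le.1 h).le] at hx; exact hx.false)
      linarith
  · rw [Set.indicator_of_notMem (by exact hx)]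
    linarith

lemma bddAbove_maxBirkhoff_map_iff (x : α) :
    BddAbove (Set.range fun N => maxBirkhoff T f N (T x)) ↔
      BddAbove (Set.range fun N => maxBirkhoff T f N x) := by
  constructor
  · rintro ⟨C, hC⟩
    refine ⟨max 0 (f x + C), ?_⟩
    rintro _ ⟨N, rfl⟩
    refine (maxBirkhoff_le_succ N x).trans (max_le_max le_rfl (add_le_add le_rfl (hC ⟨N, rfl⟩)))
  · rintro ⟨C, hC⟩
    refine ⟨C - f x, ?_⟩
    rintro _ ⟨N, rfl⟩
    have h1 : maxBirkhoff T f (N + 1) x ≤ C := hC ⟨N + 1, rfl⟩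
    have h2 : f x + maxBirkhoff T f N (T x) ≤ maxBirkhoff T f (N + 1) x := le_max_right _ _
    simp only
    linarith

variable [MeasurableSpace α] {μ : Measure α}

lemma measurable_maxBirkhoff (hT : Measurable T) (hf : Measurable f) (N : ℕ) :
    Measurable (maxBirkhoff T f N) := by
  induction N with
  | zero => exact measurable_const
  | succ N ih => exact measurable_const.max (hf.add (ih.comp hT))

lemma integrable_maxBirkhoff (hT : MeasurePreserving T μ μ) (hf : Integrable f μ) (N : ℕ) :
    Integrable (maxBirkhoff T f N) μ := by
  induction N with
  | zero => exact integrable_zero _ _ _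
  | succ N ih => exact (integrable_zero _ _ _).sup (hf.add (hT.integrable_comp_of_integrable ih))

/-- The maximal ergodic theorem. -/
theorem integral_indicator_maxBirkhoff_nonneg (hT : MeasurePreserving T μ μ) (hfm : Measurable f)
    (hf : Integrable f μ) (N : ℕ) :
    0 ≤ ∫ x, {x | 0 < maxBirkhoff T f N x}.indicator f x ∂μ := by
  have hM := integrable_maxBirkhoff hT hf N
  have hm := measurable_maxBirkhoff hT.measurable hfm N
  have hMT : Integrable (fun x => maxBirkhoff T f N (T x)) μ := hT.integrable_comp_of_integrable hM
  have hE : ∫ x, maxBirkhoff T f N (T x) ∂μ = ∫ x, maxBirkhoff T f N x ∂μ := by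
    rw [← integral_map hT.measurable.aemeasurable
      (by rw [hT.map_eq]; exact hm.aestronglyMeasurable), hT.map_eq]
  have := integral_mono (hM.sub hMT)
    (hf.indicator (measurableSet_lt measurable_const hm)) (maxBirkhoff_sub_le_indicator N)
  simpa [integral_sub hM hMT, hE] using this

/-- If `∫ f < 0`, then almost surely the Birkhoff sums of `f` are bounded above: the set where they
are not is invariant, and it cannot have full measure by the maximal ergodic theorem. -/
theorem ae_bddAbove_maxBirkhoff [IsProbabilityMeasure μ] (hT : Ergodic T μ) (hfm : Measurable f)
    (hf : Integrable f μ) (hneg : ∫ x, f x ∂μ < 0) :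
    ∀ᵐ x ∂μ, BddAbove (Set.range fun N => maxBirkhoff T f N x) := by
  have hm := measurable_maxBirkhoff hT.measurable hfm
  have hmeas : MeasurableSet {x | BddAbove (Set.range fun N => maxBirkhoff T f N x)} :=
    measurableSet_bddAbove_range hm
  have hinv : T ⁻¹' {x | BddAbove (Set.range fun N => maxBirkhoff T f N x)} =
      {x | BddAbove (Set.range fun N => maxBirkhoff T f N x)} :=
    Set.ext fun x => bddAbove_maxBirkhoff_map_iff x
  rcases hT.toPreErgodic.ae_mem_or_ae_notMem hmeas hinv with h | h
  · exact h
  · exfalso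
    have hlim : Tendsto (fun N => ∫ x, {x | 0 < maxBirkhoff T f N x}.indicator f x ∂μ) atTop
        (𝓝 (∫ x, f x ∂μ)) := by
      refine tendsto_integral_of_dominated_convergence (fun x => ‖f x‖)
        (fun N => (hfm.indicator (measurableSet_lt measurable_const (hm N))).aestronglyMeasurable)
        hf.norm (fun N => .of_forall fun x => norm_indicator_le_norm_self _ _) ?_
      filter_upwards [h] with x hx
      obtain ⟨N₀, hN₀⟩ : ∃ N, 0 < maxBirkhoff T f N x := by
        by_contra! hcon
        exact hx ⟨0, by rintro _ ⟨N, rfl⟩; exact hcon N⟩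
      refine tendsto_const_nhds.congr' ?_
      filter_upwards [eventually_ge_atTop N₀] with N hN
      exact (Set.indicator_of_mem (s := {x | 0 < maxBirkhoff T f N x})
        (hN₀.trans_le (maxBirkhoff_mono x hN)) f).symm
    exact hneg.not_ge (ge_of_tendsto' hlim
      (integral_indicator_maxBirkhoff_nonneg hT.toMeasurePreserving hfm hf))

lemma ae_eventually_birkhoffSum_div_lt [IsProbabilityMeasure μ] (hT : Ergodic T μ)
    (hfm : Measurable f) (hf : Integrable f μ) {ε : ℝ} (hε : 0 < ε) :
    ∀ᵐ x ∂μ, ∀ᶠ N : ℕ in atTop, 1 / (N : ℝ) * birkhoffSum T f N x < ∫ x, f x ∂μ + ε := by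
  set I := ∫ x, f x ∂μ
  -- half of `ε` makes the integral negative, the other half absorbs the bound on the sums
  have hint : ∫ x, (f x - (I + ε / 2)) ∂μ < 0 := by
    rw [integral_sub hf (integrable_const _)]
    simp only [integral_const, probReal_univ, one_smul]
    change I - (I + ε / 2) < 0
    linarith
  filter_upwards [ae_bddAbove_maxBirkhoff hT (hfm.sub_const _) (hf.sub (integrable_const _)) hint]
    with x hx
  obtain ⟨C, hC⟩ := hx
  have hlim : Tendsto (fun N : ℕ => C / (N : ℝ)) atTop (𝓝 0) :=
    tendsto_const_div_atTop_nhds_zero_nat C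
  filter_upwards [hlim.eventually_lt_const (half_pos hε), eventually_gt_atTop 0] with N hN hN0
  have hN0' : (0 : ℝ) < N := Nat.cast_pos.2 hN0
  have h1 : birkhoffSum T (fun x => f x - (I + ε / 2)) N x ≤ C :=
    (birkhoffSum_le_maxBirkhoff N x).trans (hC ⟨N, rfl⟩)
  have h2 : birkhoffSum T f N x ≤ C + N * (I + ε / 2) := by
    simp only [birkhoffSum, Finset.sum_sub_distrib, Finset.sum_const, Finset.card_range,
      nsmul_eq_mul] at h1 ⊢
    linarith
  calc 1 / (N : ℝ) * birkhoffSum T f N x ≤ 1 / (N : ℝ) * (C + N * (I + ε / 2)) := by gcongr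
    _ = C / N + (I + ε / 2) := by field_simp
    _ < I + ε := by linarith

lemma tendsto_birkhoffSum_of_measurable [IsProbabilityMeasure μ] (hT : Ergodic T μ)
    (hfm : Measurable f) (hf : Integrable f μ) :
    ∀ᵐ x ∂μ, Tendsto (fun N : ℕ => 1 / (N : ℝ) * birkhoffSum T f N x) atTop
      (𝓝 (∫ x, f x ∂μ)) := by
  have h1 : ∀ᵐ x ∂μ, ∀ k : ℕ, ∀ᶠ N : ℕ in atTop,
      1 / (N : ℝ) * birkhoffSum T f N x < ∫ x, f x ∂μ + 1 / ((k : ℝ) + 1) :=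
    ae_all_iff.2 fun k => ae_eventually_birkhoffSum_div_lt hT hfm hf (by positivity)
  have h2 : ∀ᵐ x ∂μ, ∀ k : ℕ, ∀ᶠ N : ℕ in atTop,
      1 / (N : ℝ) * birkhoffSum T (-f) N x < ∫ x, (-f) x ∂μ + 1 / ((k : ℝ) + 1) :=
    ae_all_iff.2 fun k => ae_eventually_birkhoffSum_div_lt hT hfm.neg hf.neg (by positivity)
  filter_upwards [h1, h2] with x hx1 hx2
  rw [Metric.tendsto_atTop']
  intro ε hε
  obtain ⟨k, hk⟩ := exists_nat_one_div_lt hε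
  obtain ⟨N₀, hN₀⟩ := eventually_atTop.1 ((hx1 k).and (hx2 k))
  refine ⟨N₀, fun N hN => ?_⟩
  obtain ⟨ha, hb⟩ := hN₀ N hN.le
  have hneg : birkhoffSum T (-f) N x = -birkhoffSum T f N x := by simp [birkhoffSum]
  simp only [hneg, Pi.neg_apply, integral_neg] at hb
  rw [Real.dist_eq, abs_lt]
  constructor <;> linarith

/-- Birkhoff's pointwise ergodic theorem for an ergodic probability-preserving map. -/
theorem tendsto_birkhoffSum [IsProbabilityMeasure μ] (hT : Ergodic T μ) (hf : Integrable f μ) :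
    ∀ᵐ x ∂μ, Tendsto (fun N : ℕ => 1 / (N : ℝ) * birkhoffSum T f N x) atTop
      (𝓝 (∫ x, f x ∂μ)) := by
  have hae := hf.aemeasurable.ae_eq_mk
  have hq := hT.toMeasurePreserving.quasiMeasurePreserving
  have hsum : ∀ᵐ x ∂μ, ∀ N, birkhoffSum T f N x = birkhoffSum T (hf.aemeasurable.mk f) N x :=
    ae_all_iff.2 fun N => hq.birkhoffSum_ae_eq_of_ae_eq hae N
  filter_upwards [hsum, tendsto_birkhoffSum_of_measurable hT hf.aemeasurable.measurable_mk
    (hf.congr hae)] with x hx hlim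
  simpa only [hx, integral_congr_ae hae] using hlim

end ErgodicThm

/-! ### Ergodicity of extensions that forget the fibre -/

/-- Let `π` be a factor map onto an ergodic system with a measurable section `s`, and suppose that
the orbits of `p` and of `s (π p)`, which lie over the same base point, are asymptotic as seen by
compactly supported continuous functions. Then the extension is ergodic: the indicator of an
invariant set is an `L¹` limit of functions `φ ∘ G^n ∘ s ∘ π`, so the set comes from the base. -/
theorem Ergodic.of_asymptotic_section {α β : Type*} [TopologicalSpace α] [NormalSpace α] [R1Space α]
    [WeaklyLocallyCompactSpace α] [MeasurableSpace α] [BorelSpace α] [MeasurableSpace β]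
    {μ : Measure α} [IsFiniteMeasure μ] [μ.Regular] {ν : Measure β} {G : α → α} {B : β → β}
    {π : α → β} {s : β → α} (hG : MeasurePreserving G μ μ) (hB : Ergodic B ν)
    (hπ : MeasurePreserving π μ ν) (hs : Measurable s) (hsemi : Function.Semiconj π G B)
    (hasymp : ∀ φ : α → ℝ, Continuous φ → HasCompactSupport φ → ∀ p,
      Tendsto (fun n => φ (G^[n] (s (π p))) - φ (G^[n] p)) atTop (𝓝 0)) :
    Ergodic G μ := by
  refine ⟨hG, ⟨fun E hE hinv => ?_⟩⟩
  let f : α → ℝ := E.indicator 1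
  have hfm : Measurable f := measurable_one.indicator hE
  have hf : MemLp f 1 μ := (memLp_const (1 : ℝ)).indicator hE
  have hfG : ∀ n, f ∘ G^[n] = f := fun n => by
    have : G^[n] ⁻¹' E = E := by
      rw [Set.preimage_iterate_eq, Function.iterate_fixed hinv]
    ext p
    have hp : G^[n] p ∈ E ↔ p ∈ E := Set.ext_iff.1 this p
    by_cases h : p ∈ E <;> simp [f, h, hp]
  -- approximation of the indicator by functions on the base
  have happrox : ∀ k : ℕ, ∃ g : β → ℝ, Measurable g ∧
      eLpNorm (g ∘ π - f) 1 μ ≤ 2 * ((k : ENNReal) + 1)⁻¹ := by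
    intro k
    have hk : ((k : ENNReal) + 1)⁻¹ ≠ 0 := by simp
    obtain ⟨φ, hφs, hφ, hφc, -⟩ := hf.exists_hasCompactSupport_eLpNorm_sub_le
      ENNReal.one_ne_top hk
    obtain ⟨C, hC⟩ := hφs.exists_bound_of_continuous hφc
    have hGn : ∀ n, Measurable (G^[n]) := fun n => hG.measurable.iterate n
    let d : ℕ → α → ℝ := fun n p => φ (G^[n] (s (π p))) - φ (G^[n] p)
    have hdm : ∀ n, Measurable (d n) := fun n =>
      (hφc.measurable.comp ((hGn n).comp (hs.comp hπ.measurable))).sub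
        (hφc.measurable.comp (hGn n))
    have hd : Tendsto (fun n => ∫⁻ p, ‖d n p‖ₑ ∂μ) atTop (𝓝 (∫⁻ _, 0 ∂μ)) := by
      refine tendsto_lintegral_of_dominated_convergence (fun _ => ENNReal.ofReal (C + C))
        (fun n => (hdm n).enorm) (fun n => .of_forall fun p => ?_) ?_
        (.of_forall fun p => ?_)
      · simp only [← ofReal_norm]
        exact ENNReal.ofReal_le_ofReal ((norm_sub_le _ _).trans (add_le_add (hC _) (hC _)))
      · simp [lintegral_const, ENNReal.mul_eq_top]
      · have := (hasymp φ hφc hφs p).enorm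
        simpa using this
    rw [lintegral_zero] at hd
    obtain ⟨n, hn⟩ := (hd.eventually_lt_const (pos_iff_ne_zero.2 hk)).exists
    refine ⟨fun q => φ (G^[n] (s q)), hφc.measurable.comp ((hGn n).comp hs), ?_⟩
    have hsplit : (fun q => φ (G^[n] (s q))) ∘ π - f = d n + (φ - f) ∘ G^[n] := by
      ext p
      have := congrFun (hfG n) p
      simp only [Function.comp_apply, Pi.sub_apply, Pi.add_apply, d] at this ⊢
      rw [this]; ring
    rw [hsplit, two_mul]
    refine (eLpNorm_add_le (hdm n).aestronglyMeasurable
      ((hφc.measurable.sub hfm).comp (hGn n)).aestronglyMeasurable le_rfl).trans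
      (add_le_add ?_ ?_)
    · rw [eLpNorm_one_eq_lintegral_enorm]; exact hn.le
    · rw [eLpNorm_comp_measurePreserving (hφc.measurable.sub hfm).aestronglyMeasurable
        (hG.iterate n), eLpNorm_sub_comm]
      exact hφ
  choose g hgm hg using happrox
  have hlim : Tendsto (fun k => eLpNorm (g k ∘ π - f) 1 μ) atTop (𝓝 0) := by
    refine tendsto_of_tendsto_of_tendsto_of_le_of_le tendsto_const_nhds ?_ (fun _ => zero_le) hg
    have h1 : Tendsto (fun k : ℕ => ((k : ENNReal) + 1)⁻¹) atTop (𝓝 0) := by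
      have := (tendsto_add_atTop_iff_nat 1).2 ENNReal.tendsto_inv_nat_nhds_zero
      simpa using this
    simpa using ENNReal.Tendsto.const_mul h1 (Or.inr (by simp : (2 : ENNReal) ≠ ⊤))
  obtain ⟨ns, -, hns⟩ := (tendstoInMeasure_of_tendsto_eLpNorm one_ne_zero
    (fun k => ((hgm k).comp hπ.measurable).aestronglyMeasurable) hfm.aestronglyMeasurable
    hlim).exists_seq_tendsto_ae
  let E' : Set β := {q | Tendsto (fun i => g (ns i) q) atTop (𝓝 1)}
  have hE' : MeasurableSet E' := measurableSet_tendsto _ fun i => hgm (ns i)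
  have hEE' : π ⁻¹' E' =ᵐ[μ] E := by
    filter_upwards [hns] with p hp
    refine propext ?_
    change Tendsto (fun i => g (ns i) (π p)) atTop (𝓝 1) ↔ p ∈ E
    change Tendsto (fun i => g (ns i) (π p)) atTop (𝓝 (f p)) at hp
    by_cases hpE : p ∈ E
    · have : f p = 1 := by simp [f, hpE]
      rw [this] at hp
      exact iff_of_true hp hpE
    · have : f p = 0 := by simp [f, hpE]
      rw [this] at hp
      exact iff_of_false (fun h => zero_ne_one (tendsto_nhds_unique hp h)) hpE
  have hinv' : B ⁻¹' E' =ᵐ[ν] E' := by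
    have h1 : π ⁻¹' (B ⁻¹' E') =ᵐ[μ] π ⁻¹' E' := by
      have : π ⁻¹' (B ⁻¹' E') = G ⁻¹' (π ⁻¹' E') := by
        ext p; simp [hsemi.eq p]
      rw [this]
      have h2 := hG.quasiMeasurePreserving.preimage_ae_eq hEE'
      rw [hinv] at h2
      exact h2.trans hEE'.symm
    rw [← hπ.map_eq]
    refine (ae_map_iff (p := fun q => (B ⁻¹' E') q = E' q) hπ.measurable.aemeasurable ?_).2 h1
    have : {q | (B ⁻¹' E') q = E' q} = {q | q ∈ B ⁻¹' E' ↔ q ∈ E'} := by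
      ext q; exact eq_iff_iff
    rw [this]
    exact (hB.measurable hE').iff hE'
  rcases hB.quasiErgodic.ae_empty_or_univ₀ hE'.nullMeasurableSet hinv' with h | h
  · have := hπ.quasiMeasurePreserving.preimage_ae_eq h
    exact (eventuallyConst_set'.2 (Or.inl (hEE'.symm.trans this)))
  · have := hπ.quasiMeasurePreserving.preimage_ae_eq h
    exact (eventuallyConst_set'.2 (Or.inr (hEE'.symm.trans this)))

namespace SkewIFS

/-! ### Bernoulli measures and one-sided sequences -/

/-- Prepend a symbol to a one-sided sequence. -/
def consSeq {α : Type*} (p : α × (ℕ → α)) : ℕ → α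
  | 0 => p.1
  | n + 1 => p.2 n

lemma measurable_consSeq {α : Type*} [MeasurableSpace α] :
    Measurable (consSeq : α × (ℕ → α) → ℕ → α) := by
  refine measurable_pi_lambda _ fun n => ?_
  cases n with
  | zero => exact measurable_fst
  | succ n => exact (measurable_pi_apply n).comp measurable_snd

lemma measurable_shift {α : Type*} [MeasurableSpace α] :
    Measurable (shift : (ℕ → α) → ℕ → α) :=
  measurable_pi_lambda _ fun n => measurable_pi_apply (n + 1)

lemma measurePreserving_consSeq {α : Type*} [MeasurableSpace α] (ρ : Measure α)
    [IsProbabilityMeasure ρ] :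
    MeasurePreserving consSeq (ρ.prod (Measure.infinitePi fun _ : ℕ => ρ))
      (Measure.infinitePi fun _ : ℕ => ρ) := by
  refine ⟨measurable_consSeq, Measure.eq_infinitePi _ fun s t ht => ?_⟩
  classical
  -- enlarge the finite set of constrained coordinates to an initial segment
  obtain ⟨N, hN⟩ : ∃ N, s ⊆ Finset.range (N + 1) :=
    ⟨s.sup id, fun i hi => Finset.mem_range_succ_iff.2 (Finset.le_sup (f := id) hi)⟩
  let t' : ℕ → Set α := fun i => if i ∈ s then t i else Set.univ
  have ht' : ∀ i, MeasurableSet (t' i) := fun i => by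
    by_cases hi : i ∈ s <;> simp [t', hi, ht]
  have hset : consSeq ⁻¹' ((s : Set ℕ).pi t) =
      t' 0 ×ˢ ((Finset.range N : Finset ℕ) : Set ℕ).pi fun i => t' (i + 1) := by
    ext ⟨i, c⟩
    simp only [Set.mem_preimage, Set.mem_pi, Set.mem_prod, Finset.mem_coe, Finset.mem_range]
    constructor
    · intro h
      refine ⟨?_, fun n _ => ?_⟩
      · by_cases h0 : 0 ∈ s
        · simpa [t', h0, consSeq] using h 0 h0
        · simp [t', h0]
      · by_cases h0 : n + 1 ∈ s
        · simpa [t', h0, consSeq] using h (n + 1) h0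
        · simp [t', h0]
    · rintro ⟨h0, h1⟩ n hn
      cases n with
      | zero => simpa [t', hn, consSeq] using h0
      | succ n =>
        have := h1 n (by have := Finset.mem_range.1 (hN hn); omega)
        simpa [t', hn, consSeq] using this
  have hprod : ∏ i ∈ s, ρ (t i) = ∏ i ∈ Finset.range (N + 1), ρ (t' i) := by
    rw [← Finset.prod_subset hN fun i _ hi => by simp [t', hi]]
    exact Finset.prod_congr rfl fun i hi => by simp [t', hi]
  rw [Measure.map_apply measurable_consSeq
    (MeasurableSet.pi s.countable_toSet fun i _ => ht i), hset, Measure.prod_prod,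
    Measure.infinitePi_pi _ fun i _ => ht' (i + 1), hprod, Finset.prod_range_succ', mul_comm]

lemma measurePreserving_head_shift {α : Type*} [MeasurableSpace α] (ρ : Measure α)
    [IsProbabilityMeasure ρ] :
    MeasurePreserving (fun b : ℕ → α => (b 0, shift b)) (Measure.infinitePi fun _ : ℕ => ρ)
      (ρ.prod (Measure.infinitePi fun _ : ℕ => ρ)) := by
  have hm : Measurable fun b : ℕ → α => (b 0, shift b) :=
    (measurable_pi_apply 0).prodMk measurable_shift
  refine ⟨hm, ?_⟩
  conv_lhs => rw [← (measurePreserving_consSeq ρ).map_eq]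
  rw [Measure.map_map hm measurable_consSeq]
  exact Measure.map_id

/-- The uniform probability measure on `k` symbols. -/
noncomputable abbrev uniformSymbol (k : ℕ) [NeZero k] : Measure (Fin k) :=
  (PMF.uniformOfFintype (Fin k)).toMeasure

instance (k : ℕ) [NeZero k] : IsProbabilityMeasure (bernoulliMeasure k) :=
  inferInstanceAs (IsProbabilityMeasure (Measure.infinitePi _))

instance : IsProbabilityMeasure (volume : Measure Circle1) :=
  ⟨by simp [AddCircle.measure_univ]⟩

/-- The two-sided shift, written on pairs of one-sided sequences. -/
lemma measurePreserving_twoSidedShift (k : ℕ) [NeZero k] :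
    MeasurePreserving
      (fun q : (ℕ → Fin k) × (ℕ → Fin k) => (consSeq (q.2 0, q.1), shift q.2))
      ((bernoulliMeasure k).prod (bernoulliMeasure k))
      ((bernoulliMeasure k).prod (bernoulliMeasure k)) := by
  have h1 := (MeasurePreserving.id (bernoulliMeasure k)).prod
    (measurePreserving_head_shift (uniformSymbol k))
  have h2 := (measurePreserving_prodAssoc (bernoulliMeasure k) (uniformSymbol k)
    (bernoulliMeasure k)).symm
  have h3 := ((measurePreserving_consSeq (uniformSymbol k)).comp
    (Measure.measurePreserving_swap (μ := bernoulliMeasure k))).prod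
      (MeasurePreserving.id (bernoulliMeasure k))
  exact h3.comp (h2.comp h1)

/-! ### The binary digit of a point of the circle -/

/-- The first binary digit, the index of the inverse branch that recovers `x` from `2 x`. -/
noncomputable def digit (x : Circle1) : Fin 2 := if rep x < 1 / 2 then 0 else 1

lemma coe_rep (x : Circle1) : ((rep x : ℝ) : Circle1) = x :=
  (AddCircle.equivIco (1 : ℝ) 0).symm_apply_apply x

lemma rep_mem (x : Circle1) : 0 ≤ rep x ∧ rep x < 1 := by
  have := (AddCircle.equivIco (1 : ℝ) 0 x).2
  simpa [rep] using this

lemma rep_coe (t : ℝ) : rep (t : Circle1) = Int.fract t := by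
  simp [rep]

lemma rep_coe_of_mem {t : ℝ} (h0 : 0 ≤ t) (h1 : t < 1) : rep (t : Circle1) = t := by
  rw [rep_coe, Int.fract_eq_self.2 ⟨h0, h1⟩]

lemma coe_sub_one (t : ℝ) : ((t - 1 : ℝ) : Circle1) = t := by
  have := AddCircle.coe_period (1 : ℝ)
  rw [AddCircle.coe_sub, this, sub_zero]

lemma measurable_rep : Measurable rep :=
  measurable_subtype_coe.comp (AddCircle.measurableEquivIco (1 : ℝ) 0).measurable

lemma measurable_digit : Measurable digit :=
  Measurable.ite (measurableSet_lt measurable_rep measurable_const) measurable_const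
    measurable_const

lemma measurable_doubling : Measurable doubling :=
  (continuous_nsmul 2).measurable

lemma tau_digit_doubling (x : Circle1) : tau (digit x) (doubling x) = x := by
  obtain ⟨h0, h1⟩ := rep_mem x
  have hd : doubling x = ((2 * rep x : ℝ) : Circle1) := by
    conv_lhs => rw [← coe_rep x]
    rw [doubling, ← AddCircle.coe_nsmul]
    simp
  by_cases h : rep x < 1 / 2
  · rw [tau, hd, rep_coe_of_mem (by linarith) (by linarith), digit, if_pos h]
    conv_rhs => rw [← coe_rep x]
    congr 1
    simp
  · rw [tau, hd, ← coe_sub_one (2 * rep x), rep_coe_of_mem (by linarith) (by linarith), digit, if_neg h]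
    conv_rhs => rw [← coe_rep x]
    congr 1
    simp
    ring

lemma digit_add_half (x : Circle1) : digit (x + ((1 / 2 : ℝ) : Circle1)) = 1 - digit x := by
  obtain ⟨h0, h1⟩ := rep_mem x
  have hd : x + ((1 / 2 : ℝ) : Circle1) = ((rep x + 1 / 2 : ℝ) : Circle1) := by
    rw [AddCircle.coe_add, coe_rep]
  by_cases h : rep x < 1 / 2
  · have h2 : rep (x + ((1 / 2 : ℝ) : Circle1)) = rep x + 1 / 2 := by
      rw [hd, rep_coe_of_mem (by linarith) (by linarith)]
    rw [digit, digit, if_pos h, if_neg (by rw [h2]; linarith)]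
    rfl
  · have h2 : rep (x + ((1 / 2 : ℝ) : Circle1)) = rep x + 1 / 2 - 1 := by
      rw [hd, ← coe_sub_one, rep_coe_of_mem (by linarith) (by linarith)]
    rw [digit, digit, if_neg h, if_pos (by rw [h2]; linarith)]
    rfl

lemma doubling_add_half (x : Circle1) : doubling (x + ((1 / 2 : ℝ) : Circle1)) = doubling x := by
  have : (2 : ℕ) • ((1 / 2 : ℝ) : Circle1) = 0 := by
    rw [← AddCircle.coe_nsmul, ← AddCircle.coe_period (1 : ℝ)]
    congr 1
    simp
  rw [doubling, doubling, smul_add, this, add_zero]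

lemma measurePreserving_doubling : MeasurePreserving doubling (volume : Measure Circle1) volume :=
  (AddCircle.ergodic_nsmul (T := 1) (n := 2) one_lt_two).toMeasurePreserving

/-- Given `2 x`, both digits of `x` are equally likely: the translation by `1 / 2` exchanges the
digits and does not change `2 x`. -/
lemma volume_digit_inter (i : Fin 2) {S : Set Circle1} (hS : MeasurableSet S) :
    volume (digit ⁻¹' {i} ∩ doubling ⁻¹' S) = volume S * 2⁻¹ := by
  have hm : ∀ i, MeasurableSet (digit ⁻¹' {i} ∩ doubling ⁻¹' S) := fun i =>
    (measurable_digit (measurableSet_singleton i)).inter (measurable_doubling hS)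
  have hswap : volume (digit ⁻¹' {0} ∩ doubling ⁻¹' S) =
      volume (digit ⁻¹' {1} ∩ doubling ⁻¹' S) := by
    rw [← (measurePreserving_add_right (volume : Measure Circle1)
      ((1 / 2 : ℝ) : Circle1)).measure_preimage (hm 0).nullMeasurableSet]
    congr 1
    ext x
    simp only [Set.mem_preimage, Set.mem_inter_iff, Set.mem_singleton_iff, digit_add_half,
      doubling_add_half]
    have : ∀ d : Fin 2, 1 - d = 0 ↔ d = 1 := by decide
    rw [this]
  have hadd : volume (digit ⁻¹' {0} ∩ doubling ⁻¹' S) +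
      volume (digit ⁻¹' {1} ∩ doubling ⁻¹' S) = volume S := by
    rw [← measurePreserving_doubling.measure_preimage hS.nullMeasurableSet,
      ← measure_union _ (hm 1)]
    · congr 1
      ext x
      have : ∀ d : Fin 2, d = 0 ∨ d = 1 := by decide
      have := this (digit x)
      simp only [Set.mem_union, Set.mem_inter_iff, Set.mem_preimage, Set.mem_singleton_iff]
      tauto
    · refine Set.disjoint_left.2 fun x hx hx' => ?_
      have h0 : digit x = 0 := hx.1
      have h1 : digit x = 1 := hx'.1
      exact zero_ne_one (h0.symm.trans h1)
  have key : ∀ a : ENNReal, a + a = volume S → a = volume S * 2⁻¹ := fun a ha => by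
    rw [← ha, ← two_mul, mul_comm, ← mul_assoc,
      ENNReal.inv_mul_cancel two_ne_zero ENNReal.ofNat_ne_top, one_mul]
  obtain rfl | rfl : i = 0 ∨ i = 1 := by omega
  · exact key _ (by rw [← hswap] at hadd; exact hadd)
  · exact key _ (by rw [hswap] at hadd; exact hadd)

lemma measurePreserving_doubling_digit :
    MeasurePreserving (fun x : Circle1 => (doubling x, digit x)) volume
      (volume.prod (uniformSymbol 2)) := by
  have hm : Measurable fun x : Circle1 => (doubling x, digit x) :=
    measurable_doubling.prodMk measurable_digit
  refine ⟨hm, (Measure.prod_eq fun S D hS hD => ?_).symm⟩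
  have h : ((volume : Measure Circle1).restrict (doubling ⁻¹' S)).map digit =
      volume S • uniformSymbol 2 := by
    refine Measure.ext_of_singleton fun i => ?_
    rw [Measure.map_apply measurable_digit (measurableSet_singleton i),
      Measure.restrict_apply (measurable_digit (measurableSet_singleton i)),
      volume_digit_inter i hS, Measure.smul_apply,
      PMF.toMeasure_apply_singleton _ _ (measurableSet_singleton i)]
    simp
  have h2 := congrArg (fun ρ : Measure (Fin 2) => ρ D) h
  simp only [Measure.map_apply measurable_digit hD,
    Measure.restrict_apply (measurable_digit hD), Measure.smul_apply, smul_eq_mul] at h2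
  rw [Measure.map_apply hm (hS.prod hD), ← h2, Set.inter_comm]
  rfl

/-- The natural extension of the doubling map, with the past recorded by binary digits. -/
lemma measurePreserving_doublingExtension :
    MeasurePreserving (fun q : Circle1 × (ℕ → Fin 2) => (doubling q.1, consSeq (digit q.1, q.2)))
      (volume.prod (bernoulliMeasure 2)) (volume.prod (bernoulliMeasure 2)) := by
  have h1 := measurePreserving_doubling_digit.prod (MeasurePreserving.id (bernoulliMeasure 2))
  have h2 := measurePreserving_prodAssoc (volume : Measure Circle1) (uniformSymbol 2)
    (bernoulliMeasure 2)
  have h3 := (MeasurePreserving.id (volume : Measure Circle1)).prod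
    (measurePreserving_consSeq (uniformSymbol 2))
  exact h3.comp (h2.comp h1)

/-! ### Invariance of the random SRB measure -/

/-- The invertible model of the skew map: a doubling map with recorded digits, times a two-sided
shift. The coding map carries it to the skew map. -/
noncomputable def codedSkew {m : ℕ} (q : Circle1 × (ℕ → Fin 2) × (ℕ → Fin m) × (ℕ → Fin m)) :
    Circle1 × (ℕ → Fin 2) × (ℕ → Fin m) × (ℕ → Fin m) :=
  (doubling q.1, consSeq (digit q.1, q.2.1), consSeq (q.2.2.2 0, q.2.2.1), shift q.2.2.2)

lemma measurePreserving_codedSkew (m : ℕ) [NeZero m] :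
    MeasurePreserving (codedSkew (m := m))
      ((volume : Measure Circle1).prod
        ((bernoulliMeasure 2).prod ((bernoulliMeasure m).prod (bernoulliMeasure m))))
      ((volume : Measure Circle1).prod
        ((bernoulliMeasure 2).prod ((bernoulliMeasure m).prod (bernoulliMeasure m)))) := by
  have h1 := measurePreserving_prodAssoc (volume : Measure Circle1) (bernoulliMeasure 2)
    ((bernoulliMeasure m).prod (bernoulliMeasure m))
  have h2 := measurePreserving_doublingExtension.prod (measurePreserving_twoSidedShift m)
  exact h1.comp (h2.comp h1.symm)

lemma tauIter_consSeq (x : Circle1) (a : ℕ → Fin 2) (n : ℕ) :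
    tauIter (consSeq (digit x, a)) (n + 1) (doubling x) = tauIter a n x := by
  induction n with
  | zero => exact tau_digit_doubling x
  | succ n ih =>
    rw [tauIter, ih]
    rfl

section

variable {m : ℕ} {lam : ℝ} {A : Fin m → Circle1 → ℝ}

lemma summable_discSum (hlam0 : 0 < lam) (hlam1 : lam < 1) (hA : ∀ c, Continuous (A c))
    (x : Circle1) (c : ℕ → Fin m) (a : ℕ → Fin 2) :
    Summable fun i : ℕ => lam ^ i * A (c i) (tauIter a (i + 1) x) := by
  have hb : ∀ c, ∃ C, ∀ x, ‖A c x‖ ≤ C := fun c => by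
    obtain ⟨C, hC⟩ := isCompact_univ.exists_bound_of_continuousOn (hA c).continuousOn
    exact ⟨C, fun x => hC x (Set.mem_univ x)⟩
  choose C hC using hb
  refine Summable.of_norm_bounded
    ((summable_geometric_of_lt_one hlam0.le hlam1).mul_right (∑ c, |C c|)) fun i => ?_
  rw [norm_mul, norm_pow, Real.norm_of_nonneg hlam0.le]
  gcongr
  exact (hC _ _).trans ((le_abs_self _).trans
    (Finset.single_le_sum (f := fun c => |C c|) (fun c _ => abs_nonneg _) (Finset.mem_univ (c i))))

lemma coding_codedSkew (hlam0 : 0 < lam) (hlam1 : lam < 1) (hA : ∀ c, Continuous (A c)) :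
    Function.Semiconj (coding lam A) codedSkew (skew lam A) := by
  rintro ⟨x, a, c, b⟩
  have hs : discSum lam A (doubling x) (consSeq (b 0, c)) (consSeq (digit x, a)) =
      A (b 0) x + lam * discSum lam A x c a := by
    rw [discSum, (summable_discSum hlam0 hlam1 hA _ _ _).tsum_eq_zero_add, discSum, ← tsum_mul_left]
    simp only [tauIter_consSeq]
    congr 1
    · simp [tauIter, consSeq]
    · refine tsum_congr fun n => ?_
      rw [pow_succ', mul_assoc]
      rfl
  simp only [coding, codedSkew, skew, baker, hs]

lemma measurable_uncurry_observable (hA : ∀ c, Continuous (A c)) :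
    Measurable fun p : Fin m × Circle1 => A p.1 p.2 :=
  measurable_from_prod_countable_right fun c => (hA c).measurable

lemma measurable_tau : Measurable fun p : Fin 2 × Circle1 => tau p.1 p.2 :=
  measurable_from_prod_countable_right fun i =>
    AddCircle.measurable_mk'.comp ((measurable_rep.div_const 2).add_const ((i : ℝ) / 2))

lemma measurable_tauIter (n : ℕ) :
    Measurable fun p : (ℕ → Fin 2) × Circle1 => tauIter p.1 n p.2 := by
  induction n with
  | zero => exact measurable_snd
  | succ n ih =>
    exact measurable_tau.comp (((measurable_pi_apply n).comp measurable_fst).prodMk ih)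

lemma measurable_coding (hlam0 : 0 < lam) (hlam1 : lam < 1) (hA : ∀ c, Continuous (A c)) :
    Measurable (coding lam A) := by
  refine measurable_fst.prodMk (Measurable.prodMk ?_ (measurable_snd.comp
    (measurable_snd.comp measurable_snd)))
  refine measurable_of_tendsto_metrizable
    (f := fun N (q : Circle1 × (ℕ → Fin 2) × (ℕ → Fin m) × (ℕ → Fin m)) =>
      ∑ i ∈ Finset.range N, lam ^ i * A (q.2.2.1 i) (tauIter q.2.1 (i + 1) q.1))
    (fun N => Finset.measurable_sum _ fun i _ => ?_)
    (tendsto_pi_nhds.2 fun q => (summable_discSum hlam0 hlam1 hA _ _ _).hasSum.tendsto_sum_nat)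
  refine ((measurable_uncurry_observable hA).comp (Measurable.prodMk ?_
    ((measurable_tauIter (i + 1)).comp
      ((measurable_fst.comp measurable_snd).prodMk measurable_fst)))).const_mul (lam ^ i)
  exact (measurable_pi_apply i).comp (measurable_fst.comp (measurable_snd.comp measurable_snd))

lemma measurable_skew (hA : ∀ c, Continuous (A c)) : Measurable (skew lam A) := by
  have hb : Measurable fun p : Circle1 × ℝ × (ℕ → Fin m) => p.2.2 :=
    measurable_snd.comp measurable_snd
  refine (measurable_doubling.comp measurable_fst).prodMk (Measurable.prodMk ?_
    (measurable_shift.comp hb))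
  exact ((measurable_uncurry_observable hA).comp
    (((measurable_pi_apply 0).comp hb).prodMk measurable_fst)).add
      ((measurable_fst.comp measurable_snd).const_mul lam)

variable [NeZero m]

lemma measurePreserving_coding (hlam0 : 0 < lam) (hlam1 : lam < 1) (hA : ∀ c, Continuous (A c)) :
    MeasurePreserving (coding lam A)
      ((volume : Measure Circle1).prod
        ((bernoulliMeasure 2).prod ((bernoulliMeasure m).prod (bernoulliMeasure m))))
      (randomSRB lam A) :=
  ⟨measurable_coding hlam0 hlam1 hA, rfl⟩

lemma measurePreserving_skew (hlam0 : 0 < lam) (hlam1 : lam < 1) (hA : ∀ c, Continuous (A c)) :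
    MeasurePreserving (skew lam A) (randomSRB lam A) (randomSRB lam A) :=
  (measurePreserving_coding hlam0 hlam1 hA).of_semiconj (measurePreserving_codedSkew m)
    (coding_codedSkew hlam0 hlam1 hA) (measurable_skew hA)

end

end SkewIFS

namespace SkewIFS

/-! ### Ergodicity of the base -/

section

variable {m : ℕ} [NeZero m]

instance : (uniformSymbol m).IsAddLeftInvariant := by
  refine ⟨fun g => Measure.ext_of_singleton fun i => ?_⟩
  have : (fun x : Fin m => g + x) ⁻¹' {i} = {-g + i} := by
    ext x
    simp [eq_neg_add_iff_add_eq]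
  rw [Measure.map_apply (measurable_of_countable _) (measurableSet_singleton i), this,
    PMF.toMeasure_apply_singleton _ _ (measurableSet_singleton _),
    PMF.toMeasure_apply_singleton _ _ (measurableSet_singleton _)]
  simp

instance : (bernoulliMeasure m).IsAddLeftInvariant := by
  refine ⟨fun g => ?_⟩
  have h := Measure.infinitePi_map_pi (fun _ : ℕ => uniformSymbol m)
    (f := fun i (x : Fin m) => g i + x) (fun i => measurable_of_countable _)
  simp only [map_add_left_eq_self] at h
  exact h

/-- The base of the skew map, as an endomorphism of the compact group `ℝ/ℤ × (ℤ/m)^ℕ`. -/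
def baseHom (m : ℕ) [NeZero m] : Circle1 × (ℕ → Fin m) →+ Circle1 × (ℕ → Fin m) where
  toFun q := (doubling q.1, shift q.2)
  map_zero' := by ext <;> simp [doubling, shift]
  map_add' p q := by ext <;> simp [doubling, shift]

lemma baseHom_iterate (n : ℕ) (q : Circle1 × (ℕ → Fin m)) :
    (baseHom m)^[n] q = ((2 ^ n : ℕ) • q.1, fun k => q.2 (k + n)) := by
  induction n generalizing q with
  | zero => simp
  | succ n ih =>
    rw [Function.iterate_succ_apply, ih]
    refine Prod.ext ?_ (funext fun k => ?_)
    · change (2 ^ n : ℕ) • (2 : ℕ) • q.1 = _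
      rw [← mul_smul, pow_succ]
    · change q.2 (k + n + 1) = _
      rfl

open scoped Pointwise in
/-- The points eventually sent to `0`, dyadic rationals paired with finitely supported sequences,
are dense. -/
lemma dense_iUnion_preimage_baseHom : Dense (⋃ n, (baseHom m)^[n] ⁻¹' 0) := by
  rintro ⟨x, b⟩
  let u : ℕ → Circle1 × (ℕ → Fin m) := fun n =>
    ((((⌊rep x * 2 ^ n⌋₊ : ℝ) / 2 ^ n : ℝ) : Circle1), fun k => if k < n then b k else 0)
  have hu : Tendsto u atTop (𝓝 (x, b)) := by
    refine Tendsto.prodMk_nhds ?_ (tendsto_pi_nhds.2 fun k => ?_)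
    · have h1 : Tendsto (fun n : ℕ => (⌊rep x * 2 ^ n⌋₊ : ℝ) / 2 ^ n) atTop (𝓝 (rep x)) :=
        (tendsto_nat_floor_mul_div_atTop (rep_mem x).1).comp
          (tendsto_pow_atTop_atTop_of_one_lt (one_lt_two : (1 : ℝ) < 2))
      have h2 := ((AddCircle.continuous_mk' (1 : ℝ)).tendsto (rep x)).comp h1
      change Tendsto _ atTop (𝓝 ((rep x : ℝ) : Circle1)) at h2
      rw [coe_rep] at h2
      exact h2
    · refine tendsto_const_nhds.congr' ?_
      filter_upwards [eventually_gt_atTop k] with n hn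
      simp [hn]
  refine mem_closure_of_tendsto hu (.of_forall fun n => Set.mem_iUnion.2 ⟨n, ?_⟩)
  rw [Set.mem_preimage, baseHom_iterate, Set.mem_zero]
  refine Prod.ext ?_ (funext fun k => by simp [u])
  change (2 ^ n : ℕ) • (((⌊rep x * 2 ^ n⌋₊ : ℝ) / 2 ^ n : ℝ) : Circle1) = 0
  rw [← AddCircle.coe_nsmul, AddCircle.coe_eq_zero_iff]
  refine ⟨⌊rep x * 2 ^ n⌋₊, ?_⟩
  simp
  field_simp

instance : ((volume : Measure Circle1).prod (bernoulliMeasure m)).IsAddLeftInvariant :=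
  Measure.prod.instIsAddLeftInvariant

lemma ergodic_baseHom :
    Ergodic (baseHom m) ((volume : Measure Circle1).prod (bernoulliMeasure m)) where
  toMeasurePreserving := measurePreserving_doubling.prod
    (measurePreserving_snd.comp (measurePreserving_head_shift (uniformSymbol m)))
  toPreErgodic := (baseHom m).preErgodic_of_dense_iUnion_preimage_zero
    dense_iUnion_preimage_baseHom

end

/-! ### Ergodicity of the random SRB measure -/

section

variable {m : ℕ} {lam : ℝ} {A : Fin m → Circle1 → ℝ}

/-- Iterates of the skew map are affine in the fibre variable, with slope `lam ^ n`. -/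
lemma skew_iterate (n : ℕ) (x : Circle1) (y : ℝ) (b : ℕ → Fin m) :
    (skew lam A)^[n] (x, y, b) =
      (((skew lam A)^[n] (x, 0, b)).1, ((skew lam A)^[n] (x, 0, b)).2.1 + lam ^ n * y,
        ((skew lam A)^[n] (x, 0, b)).2.2) := by
  induction n with
  | zero => simp
  | succ n ih =>
    rw [Function.iterate_succ_apply', ih, Function.iterate_succ_apply']
    simp only [skew, baker, Prod.mk.injEq, true_and, and_true]
    ring

/-- Compactly supported continuous functions cannot tell orbits in the same fibre apart in the
limit: they are uniformly continuous, and the skew map contracts the fibres. -/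
lemma tendsto_sub_skew_iterate (hlam0 : 0 < lam) (hlam1 : lam < 1)
    {φ : Circle1 × ℝ × (ℕ → Fin m) → ℝ} (hφ : Continuous φ) (hφs : HasCompactSupport φ)
    (p : Circle1 × ℝ × (ℕ → Fin m)) :
    Tendsto (fun n => φ ((skew lam A)^[n] (p.1, 0, p.2.2)) - φ ((skew lam A)^[n] p)) atTop
      (𝓝 0) := by
  obtain ⟨x, y, b⟩ := p
  let _ : UniformSpace (ℕ → Fin m) := uniformSpaceOfCompactR1
  have huc : UniformContinuous φ := hφs.uniformContinuous_of_continuous hφ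
  have hy : Tendsto (fun n => (((skew lam A)^[n] (x, 0, b)).2.1, ((skew lam A)^[n] (x, y, b)).2.1))
      atTop (uniformity ℝ) := by
    rw [Metric.uniformity_eq_comap_nhds_zero, tendsto_comap_iff]
    have h : Tendsto (fun n : ℕ => |lam ^ n * y|) atTop (𝓝 0) := by
      have := ((tendsto_pow_atTop_nhds_zero_of_lt_one hlam0.le hlam1).mul_const y).abs
      simpa using this
    refine h.congr fun n => ?_
    simp only [Function.comp_apply]
    rw [skew_iterate n x y b, Real.dist_eq, sub_add_cancel_left, abs_neg]
  have hp : Tendsto (fun n => ((skew lam A)^[n] (x, 0, b), (skew lam A)^[n] (x, y, b)))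
      atTop (uniformity (Circle1 × ℝ × (ℕ → Fin m))) := by
    simp only [uniformity_prod, tendsto_inf, tendsto_comap_iff, comap_inf, comap_comap]
    refine ⟨?_, hy, ?_⟩
    · refine (tendsto_diag_uniformity (fun n => ((skew lam A)^[n] (x, 0, b)).1) atTop).congr
        fun n => ?_
      simp [skew_iterate n x y b]
    · refine (tendsto_diag_uniformity (fun n => ((skew lam A)^[n] (x, 0, b)).2.2) atTop).congr
        fun n => ?_
      simp [skew_iterate n x y b]
  have h := Filter.Tendsto.comp huc hp
  rw [Metric.uniformity_eq_comap_nhds_zero, tendsto_comap_iff] at h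
  rw [tendsto_zero_iff_norm_tendsto_zero]
  exact h

variable [NeZero m]

lemma isProbabilityMeasure_randomSRB (hlam0 : 0 < lam) (hlam1 : lam < 1)
    (hA : ∀ c, Continuous (A c)) : IsProbabilityMeasure (randomSRB lam A) :=
  Measure.isProbabilityMeasure_map (measurable_coding hlam0 hlam1 hA).aemeasurable

lemma measurePreserving_base_projection (hlam0 : 0 < lam) (hlam1 : lam < 1)
    (hA : ∀ c, Continuous (A c)) :
    MeasurePreserving (fun p : Circle1 × ℝ × (ℕ → Fin m) => (p.1, p.2.2)) (randomSRB lam A)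
      ((volume : Measure Circle1).prod (bernoulliMeasure m)) := by
  have h : MeasurePreserving
      (fun q : Circle1 × (ℕ → Fin 2) × (ℕ → Fin m) × (ℕ → Fin m) => (q.1, q.2.2.2)) _ _ :=
    (MeasurePreserving.id (volume : Measure Circle1)).prod
      (measurePreserving_snd.comp (measurePreserving_snd (μ := bernoulliMeasure 2)
        (ν := (bernoulliMeasure m).prod (bernoulliMeasure m))))
  exact MeasurePreserving.map_of_comp (f := coding lam A) h
    (measurable_fst.prodMk (measurable_snd.comp measurable_snd))
    (measurable_coding hlam0 hlam1 hA)

theorem ergodic_skew (hlam0 : 0 < lam) (hlam1 : lam < 1) (hA : ∀ c, Continuous (A c)) :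
    Ergodic (skew lam A) (randomSRB lam A) := by
  have := isProbabilityMeasure_randomSRB hlam0 hlam1 hA
  exact Ergodic.of_asymptotic_section (s := fun q => (q.1, 0, q.2))
    (measurePreserving_skew hlam0 hlam1 hA) ergodic_baseHom
    (measurePreserving_base_projection hlam0 hlam1 hA)
    (measurable_fst.prodMk (measurable_const.prodMk measurable_snd)) (fun _ => rfl)
    fun _ hφ hφs p => tendsto_sub_skew_iterate hlam0 hlam1 hφ hφs p

end

end SkewIFS

theorem mainTheorem1 (m : ℕ) [NeZero m] (lam : ℝ) (hlam0 : 0 < lam) (hlam1 : lam < 1)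
    (A : Fin m → SkewIFS.Circle1 → ℝ) (hA : ∀ c : Fin m, ∃ K : NNReal, LipschitzWith K (A c)) :
    IsProbabilityMeasure (SkewIFS.randomSRB lam A) ∧
    Ergodic (SkewIFS.skew lam A) (SkewIFS.randomSRB lam A) ∧
    ∀ g : SkewIFS.Circle1 × ℝ × (ℕ → Fin m) → ℝ, Integrable g (SkewIFS.randomSRB lam A) →
      ∀ᵐ p ∂(SkewIFS.randomSRB lam A),
        Tendsto
          (fun N : ℕ => (1 / (N : ℝ)) * ∑ j ∈ Finset.range N, g ((SkewIFS.skew lam A)^[j] p))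
          atTop (𝓝 (∫ p, g p ∂(SkewIFS.randomSRB lam A))) := by
  have hc : ∀ c, Continuous (A c) := fun c => (hA c).choose_spec.continuous
  have hp := SkewIFS.isProbabilityMeasure_randomSRB hlam0 hlam1 hc
  have hE := SkewIFS.ergodic_skew hlam0 hlam1 hc
  exact ⟨hp, hE, fun g hg => ErgodicThm.tendsto_birkhoffSum hE hg⟩
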